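/- Let $M_1$ and $M_2$ be matroids on the same finite ground set $E$, with rank functions $\operatorname{rk}_1$ and $\operatorname{rk}_2$, such that every flat of $M_2$ is a flat of $M_1$; that is, $f\colon M_1 \twoheadrightarrow M_2$ is a matroid quotient, with underlying map the identity of $E$. Put $n(A)=\operatorname{rk}_1(A)-\operatorname{rk}_2(A)$ for $A\subseteq E$ and let $k=n(E)$ be the nullity of $f$. For $0\le i\le k$ the $i$-th Higgs lift $L^i(f)$ is the matroid on $E$ whose flats are the flats of $M_2$ together with the flats $F$ of $M_1$ with $n(F)<i$. The Higgs factorization of $f$ is the diagram of quotients $M_1=L^k(f)\twoheadrightarrow L^{k-1}(f)\twoheadrightarrow\cdots\twoheadrightarrow L^1(f)\twoheadrightarrow L^0(f)=M_2$. The Higgs major of $f$ is the $k$-th Higgs lift of the quotient $M_1\oplus U_{k,k}\twoheadrightarrow M_2\oplus U_{0,k}$. Let $K$ be a field. A map $\varphi\colon E\to V$ to a $K$-vector space realizes a matroid $M$ on $E$ if $\dim V=\operatorname{rk}(M)$ and a subset $A\subseteq E$ is independent in $M$ if and only if the family $(\varphi(e))_{e\in A}$ is linearly independent; $M$ is realizable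 over $K$ if such a map exists. A diagram of matroids $M_\lambda$ on $E_\lambda$ and morphisms $f_a\colon M_\lambda\to M_{\lambda'}$ is realizable over $K$ if there are maps $\varphi_\lambda\colon E_\lambda\to V_\lambda$, one for each $\lambda$, realizing the $M_\lambda$, and for each morphism $f_a\colon M_\lambda\to M_{\lambda'}$ of the diagram a linear map $g_a\colon V_\lambda\to V_{\lambda'}$ with $g_a\circ\varphi_\lambda=\varphi_{\lambda'}\circ f_a$. A single morphism or quotient is realizable over $K$ if it is realizable as a diagram with one arrow. **Theorem.** Let $f\colon M_1\twoheadrightarrow M_2$ be a matroid quotient (on a finite ground set), and let $K$ be an infinite field. The following are equivalent: 1. $f$ is realizable over $K$; 2. the Higgs factorization of $f$ is realizable over $K$ as a diagram of matroids; 3. the Higgs major of $f$ is realizable over $K$. -/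

import Mathlib

universe u v

namespace Matroid

variable {α : Type u} {β : Type v}

/-- A morphism of matroids: a map of the ground sets under which the preimage of every flat
is a flat. -/
def IsMorphism (M : Matroid α) (N : Matroid β) (f : α → β) : Prop :=
  Set.MapsTo f M.E N.E ∧ ∀ F : Set β, N.IsFlat F → M.IsFlat (f ⁻¹' F ∩ M.E)

/-- `M ↠ N` is a quotient: `M` and `N` have the same ground set, and the identity is a morphism
from `M` to `N`. -/
def IsQuotient (M N : Matroid α) : Prop :=
  M.E = N.E ∧ M.IsMorphism N id

/-- The rank of a set, as a natural number (the matroids considered here are finite). -/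
noncomputable def natRk (M : Matroid α) (A : Set α) : ℕ := (M.eRk A).toNat

/-- The nullity `rk_M A - rk_N A` of a set `A` with respect to a quotient `M ↠ N`. (For a quotient
of finite matroids one has `rk_N A ≤ rk_M A`, see `IsQuotient.natRk_le`.) -/
noncomputable def setNullity (M N : Matroid α) (A : Set α) : ℕ := M.natRk A - N.natRk A

/-- The nullity `rk M - rk N` of a quotient `M ↠ N`. -/
noncomputable def quotientNullity (M N : Matroid α) : ℕ := M.natRk M.E - N.natRk N.E

section Realizability

variable (K : Type v) [Field K]

/-- The map `φ` from the ground set of the finite matroid `M` to the `K`-vector space `V` realizes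
`M`: `dim V` is the rank of `M`, and a subset of the ground set is independent in `M` if and only
if its image is a linearly independent family. (Values of `φ` off the ground set play no role.) -/
def Realizes (M : Matroid α) (V : Type v) [AddCommGroup V] [Module K V] (φ : α → V) : Prop :=
  Module.Finite K V ∧ (Module.finrank K V : ℕ∞) = M.eRank ∧
    ∀ A ⊆ M.E, M.Indep A ↔ LinearIndepOn K φ A

/-- A finite matroid is realizable over `K`. -/
def Realizable (M : Matroid α) : Prop :=
  ∃ (V : Type v) (_ : AddCommGroup V) (_ : Module K V) (φ : α → V), M.Realizes K V φ

/-- The morphism of finite matroids `f : M → N` is realizable over `K`: there are maps realizing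
`M` and `N`, and a linear map making the square with `f` commute. -/
def MorphismRealizable {α β : Type u} (M : Matroid α) (N : Matroid β) (f : α → β) : Prop :=
  ∃ (V W : Type v) (_ : AddCommGroup V) (_ : Module K V) (_ : AddCommGroup W) (_ : Module K W)
    (φ : α → V) (ψ : β → W) (g : V →ₗ[K] W),
    M.Realizes K V φ ∧ N.Realizes K W ψ ∧ ∀ e ∈ M.E, g (φ e) = ψ (f e)

end Realizability

/-- A diagram of matroids: a family of matroids, with a family of morphisms between them. -/
structure Diagram where
  /-- the indices of the matroids -/
  Obj : Type
  /-- the indices of the morphisms -/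
  Hom : Type
  /-- the type carrying the ground set of each matroid -/
  carrier : Obj → Type u
  /-- the matroids -/
  mat : ∀ i, Matroid (carrier i)
  /-- the source of each morphism -/
  src : Hom → Obj
  /-- the target of each morphism -/
  tgt : Hom → Obj
  /-- the map underlying each morphism -/
  map : ∀ a, carrier (src a) → carrier (tgt a)
  isMorphism : ∀ a, (mat (src a)).IsMorphism (mat (tgt a)) (map a)

/-- A diagram of (finite) matroids is realizable over `K`: there are maps realizing its matroids,
one for each matroid, such that each morphism is covered by a linear map. -/
def Diagram.Realizable (D : Diagram.{u}) (K : Type v) [Field K] : Prop :=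
  ∃ (V : D.Obj → Type v) (_ : ∀ i, AddCommGroup (V i)) (_ : ∀ i, Module K (V i))
    (φ : ∀ i, D.carrier i → V i),
    (∀ i, (D.mat i).Realizes K (V i) (φ i)) ∧
    ∀ a : D.Hom, ∃ g : V (D.src a) →ₗ[K] V (D.tgt a),
      ∀ e ∈ (D.mat (D.src a)).E, g (φ (D.src a) e) = φ (D.tgt a) (D.map a e)

/-! ### Basic facts on quotients -/

lemma IsQuotient.isFlat {M N : Matroid α} (h : M.IsQuotient N) {F : Set α} (hF : N.IsFlat F) :
    M.IsFlat F := by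
  have h1 := h.2.2 F hF
  have h2 : F ⊆ M.E := h.1 ▸ hF.subset_ground
  rwa [Set.preimage_id, Set.inter_eq_left.2 h2] at h1

lemma isQuotient_of_isFlat {M N : Matroid α} (hE : M.E = N.E)
    (h : ∀ F, N.IsFlat F → M.IsFlat F) : M.IsQuotient N := by
  refine ⟨hE, fun e he => hE ▸ he, fun F hF => ?_⟩
  have h2 : F ⊆ M.E := hE ▸ hF.subset_ground
  rw [Set.preimage_id, Set.inter_eq_left.2 h2]
  exact h F hF

lemma IsQuotient.closure_subset {M N : Matroid α} (h : M.IsQuotient N) (X : Set α) :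
    M.closure X ⊆ N.closure X := by
  rw [closure_def, closure_def]
  exact Set.sInter_subset_sInter fun F hF => ⟨h.isFlat hF.1, h.1 ▸ hF.2⟩

lemma IsQuotient.eRk_le {M N : Matroid α} (h : M.IsQuotient N) (X : Set α) :
    N.eRk X ≤ M.eRk X := by
  obtain ⟨I, hI⟩ := M.exists_isBasis' X
  have hsub : X ∩ N.E ⊆ N.closure I := by
    rw [← h.1]
    exact (M.inter_ground_subset_closure X).trans
      (hI.closure_eq_closure ▸ h.closure_subset I)
  calc N.eRk X = N.eRk (X ∩ N.E) := (N.eRk_inter_ground X).symm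
    _ ≤ N.eRk (N.closure I) := N.eRk_mono hsub
    _ = N.eRk I := N.eRk_closure_eq I
    _ ≤ I.encard := N.eRk_le_encard I
    _ = M.eRk X := hI.encard_eq_eRk

lemma natCast_natRk (M : Matroid α) [M.Finite] (A : Set α) : (M.natRk A : ℕ∞) = M.eRk A :=
  ENat.natCast_toNat (M.isRkFinite_set A).eRk_lt_top.ne

lemma IsQuotient.finite {M N : Matroid α} [hM : M.Finite] (h : M.IsQuotient N) : N.Finite :=
  ⟨h.1 ▸ hM.ground_finite⟩

lemma IsQuotient.natRk_le {M N : Matroid α} [M.Finite] (h : M.IsQuotient N) (A : Set α) :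
    N.natRk A ≤ M.natRk A := by
  have := h.finite
  have h1 := h.eRk_le A
  rw [← natCast_natRk, ← natCast_natRk] at h1
  exact_mod_cast h1

lemma isFlat_iff_natRk (M : Matroid α) [M.Finite] {F : Set α} :
    M.IsFlat F ↔ F ⊆ M.E ∧ ∀ e ∈ M.E \ F, M.natRk F < M.natRk (insert e F) := by
  constructor
  · refine fun hF => ⟨hF.subset_ground, fun e he => ?_⟩
    have h1 := M.eRk_insert_eq_add_one (X := F) (e := e) (by rwa [hF.closure])
    rw [← natCast_natRk, ← natCast_natRk] at h1
    have h2 : M.natRk (insert e F) = M.natRk F + 1 := by exact_mod_cast h1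
    omega
  · rintro ⟨hFE, hF⟩
    rw [isFlat_iff_closure_eq]
    refine (M.subset_closure F hFE).antisymm' fun e he => ?_
    by_contra heF
    have h1 := hF e ⟨M.closure_subset_ground F he, heF⟩
    have h2 : M.eRk (insert e F) ≤ M.eRk F := by
      rw [← M.eRk_closure_eq F]
      exact M.eRk_mono (Set.insert_subset he (M.subset_closure F hFE))
    rw [← natCast_natRk, ← natCast_natRk] at h2
    have h3 : M.natRk (insert e F) ≤ M.natRk F := by exact_mod_cast h2
    omega

lemma sum_isFlat_iff {M : Matroid α} {N : Matroid β} {F : Set (α ⊕ β)} :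
    (M.sum N).IsFlat F ↔ M.IsFlat (Sum.inl ⁻¹' F) ∧ N.IsFlat (Sum.inr ⁻¹' F) := by
  constructor
  · intro h
    have hE := h.subset_ground
    rw [sum_ground] at hE
    have h1 : Sum.inl ⁻¹' F ⊆ M.E := fun x hx => by simpa using hE hx
    have h2 : Sum.inr ⁻¹' F ⊆ N.E := fun x hx => by simpa using hE hx
    obtain ⟨I₀, hI₀⟩ := M.exists_isBasis _ h1
    obtain ⟨J₀, hJ₀⟩ := N.exists_isBasis _ h2
    refine ⟨⟨fun I X hI hX x hx => ?_, h1⟩, ⟨fun I X hI hX x hx => ?_, h2⟩⟩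
    · have := h.subset_of_isBasis_of_isBasis (I := Sum.inl '' I ∪ Sum.inr '' J₀)
        (X := Sum.inl '' X ∪ Sum.inr '' (Sum.inr ⁻¹' F))
        (by simpa [Set.preimage_image_eq _ Sum.inl_injective,
              Set.preimage_image_eq _ Sum.inr_injective] using ⟨hI, hJ₀⟩)
        (by simpa [Set.preimage_image_eq _ Sum.inl_injective,
              Set.preimage_image_eq _ Sum.inr_injective] using ⟨hX, hJ₀⟩)
      exact this (Or.inl ⟨x, hx, rfl⟩)
    · have := h.subset_of_isBasis_of_isBasis (I := Sum.inl '' I₀ ∪ Sum.inr '' I)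
        (X := Sum.inl '' (Sum.inl ⁻¹' F) ∪ Sum.inr '' X)
        (by simpa [Set.preimage_image_eq _ Sum.inl_injective,
              Set.preimage_image_eq _ Sum.inr_injective] using ⟨hI₀, hI⟩)
        (by simpa [Set.preimage_image_eq _ Sum.inl_injective,
              Set.preimage_image_eq _ Sum.inr_injective] using ⟨hI₀, hX⟩)
      exact this (Or.inr ⟨x, hx, rfl⟩)
  · rintro ⟨h1, h2⟩
    refine ⟨fun I X hI hX => ?_, ?_⟩
    · rw [sum_isBasis_iff] at hI hX
      rintro (x | x) hx
      · exact h1.subset_of_isBasis_of_isBasis hI.1 hX.1 hx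
      · exact h2.subset_of_isBasis_of_isBasis hI.2 hX.2 hx
    · rw [sum_ground]
      rintro (x | x) hx
      · exact Or.inl ⟨x, h1.subset_ground hx, rfl⟩
      · exact Or.inr ⟨x, h2.subset_ground hx, rfl⟩

/-! ### Higgs lifts -/

section HiggsLift

variable {M N : Matroid α}

/-- The key step in the construction of the Higgs lift: if a set `I` that is independent in the
lift cannot be enlarged in it by an element of `A`, then the rank of `A` in the lift is `|I|`. -/
lemma IsQuotient.higgs_aux [M.Finite] (h : M.IsQuotient N) {i : ℕ} {I A : Set α}
    (hI : M.Indep I) (hIc : I.encard ≤ N.eRk I + i) (hA : A ⊆ M.E)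
    (hmax : ∀ e ∈ A, e ∉ I → M.Indep (insert e I) →
      ¬ (insert e I).encard ≤ N.eRk (insert e I) + i) :
    M.eRk A ≤ I.encard ∨ N.eRk A + i ≤ I.encard := by
  have := h.finite
  have hIfin : I.Finite := M.set_finite I hI.subset_ground
  have hE := h.1
  rcases hIc.lt_or_eq with hlt | heq
  · left
    have hsub : A ⊆ M.closure I := by
      intro e he
      by_contra hcl
      have heI : e ∉ I := fun h' => hcl (M.subset_closure I hI.subset_ground h')
      have hins : M.Indep (insert e I) := (hI.notMem_closure_iff_of_notMem heI (hA he)).1 hcl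
      refine hmax e he heI hins ?_
      rw [Set.encard_insert_of_notMem heI]
      refine (Order.add_one_le_of_lt hlt).trans ?_
      gcongr
      exact N.eRk_mono (Set.subset_insert e I)
    calc M.eRk A ≤ M.eRk (M.closure I) := M.eRk_mono hsub
      _ = I.encard := by rw [eRk_closure_eq, hI.eRk_eq_encard]
  · right
    have hsub : A ⊆ N.closure I := by
      intro e he
      by_contra hcl
      have hcl' : e ∉ M.closure I := fun h' => hcl (h.closure_subset I h')
      have heI : e ∉ I := fun h' => hcl' (M.subset_closure I hI.subset_ground h')
      have hins : M.Indep (insert e I) := (hI.notMem_closure_iff_of_notMem heI (hA he)).1 hcl'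
      refine hmax e he heI hins ?_
      rw [Set.encard_insert_of_notMem heI, N.eRk_insert_eq_add_one ⟨hE ▸ hA he, hcl⟩, heq]
      exact (add_right_comm _ _ _).le
    calc N.eRk A + i ≤ N.eRk (N.closure I) + i := by gcongr; exact N.eRk_mono hsub
      _ = I.encard := by rw [eRk_closure_eq, heq]

/-- The `i`-th Higgs lift `Lⁱ` of a quotient `M ↠ N` of finite matroids. It is given here by its
independent sets (the sets `I` independent in `M` with `|I| ≤ rk_N I + i`); equivalently, its flats
are the flats of `N` together with the flats of `M` of nullity less than `i`, see
`isFlat_higgsLift_iff`. -/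
noncomputable def higgsLift [hM : M.Finite] (h : M.IsQuotient N) (i : ℕ) : Matroid α :=
  (IndepMatroid.ofFinite hM.ground_finite
    (fun I => M.Indep I ∧ I.encard ≤ N.eRk I + i)
    (by simp)
    (by
      rintro I J ⟨hJ, hJc⟩ hIJ
      refine ⟨hJ.subset hIJ, ?_⟩
      have hJfin : J.Finite := M.set_finite J hJ.subset_ground
      have h1 : J.encard ≤ N.eRk I + i + (J \ I).encard := by
        refine hJc.trans ?_
        rw [add_right_comm]
        gcongr
        calc N.eRk J = N.eRk (I ∪ J \ I) := by rw [Set.union_sdiff_cancel hIJ]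
          _ ≤ N.eRk I + (J \ I).encard := N.eRk_union_le_eRk_add_encard _ _
      rw [← Set.encard_sdiff_add_encard_of_subset hIJ, add_comm] at h1
      exact (WithTop.add_le_add_iff_right (hJfin.subset Set.sdiff_subset).encard_lt_top.ne).1 h1)
    (by
      rintro I J ⟨hI, hIc⟩ ⟨hJ, hJc⟩ hlt
      by_contra! hcon
      have hIfin : I.Finite := M.set_finite I hI.subset_ground
      have hJfin : J.Finite := M.set_finite J hJ.subset_ground
      have hle : J.encard ≤ I.encard := by
        rcases h.higgs_aux hI hIc hJ.subset_ground
          (fun e he heI hins => not_le.2 (hcon e he heI hins)) with h1 | h1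
        · rwa [hJ.eRk_eq_encard] at h1
        · exact hJc.trans h1
      rw [← hIfin.cast_ncard_eq, ← hJfin.cast_ncard_eq] at hle
      have : J.ncard ≤ I.ncard := by exact_mod_cast hle
      omega)
    (fun I hI => hI.1.subset_ground)).matroid

@[simp] lemma higgsLift_ground [M.Finite] (h : M.IsQuotient N) (i : ℕ) :
    (higgsLift h i).E = M.E := rfl

lemma higgsLift_indep_iff [M.Finite] (h : M.IsQuotient N) (i : ℕ) (I : Set α) :
    (higgsLift h i).Indep I ↔ M.Indep I ∧ I.encard ≤ N.eRk I + i := Iff.rfl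

instance higgsLift_finite [hM : M.Finite] (h : M.IsQuotient N) (i : ℕ) :
    (higgsLift h i).Finite := ⟨hM.ground_finite⟩

lemma natRk_higgsLift [M.Finite] (h : M.IsQuotient N) (i : ℕ) {A : Set α} (hA : A ⊆ M.E) :
    (higgsLift h i).natRk A = min (M.natRk A) (N.natRk A + i) := by
  have := h.finite
  obtain ⟨I, hI⟩ := (higgsLift h i).exists_isBasis A hA
  have hI' := (higgsLift_indep_iff h i I).1 hI.indep
  have h1 : I.encard ≤ M.eRk A := by
    rw [← hI'.1.eRk_eq_encard]; exact M.eRk_mono hI.subset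
  have h2 : I.encard ≤ N.eRk A + i := by
    refine hI'.2.trans ?_
    gcongr
    exact N.eRk_mono hI.subset
  have h3 := h.higgs_aux hI'.1 hI'.2 hA (fun e he heI hins hle => heI <|
    hI.mem_of_insert_indep he ((higgsLift_indep_iff h i _).2 ⟨hins, hle⟩))
  rw [hI.encard_eq_eRk] at h1 h2 h3
  simp only [← natCast_natRk] at h1 h2 h3
  norm_cast at h1 h2 h3
  omega

/-- The flats of the `i`-th Higgs lift of `M ↠ N` are the flats of `N`, together with the flats of
`M` of nullity strictly less than `i`. -/
lemma isFlat_higgsLift_iff [M.Finite] (h : M.IsQuotient N) (i : ℕ) (F : Set α) :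
    (higgsLift h i).IsFlat F ↔ N.IsFlat F ∨ (M.IsFlat F ∧ setNullity M N F < i) := by
  have := h.finite
  have hE := h.1
  constructor
  · intro hF
    have hFE : F ⊆ M.E := hF.subset_ground
    have hF' := ((higgsLift h i).isFlat_iff_natRk.1 hF).2
    rw [natRk_higgsLift h i hFE] at hF'
    have key : ∀ e ∈ M.E \ F, min (M.natRk F) (N.natRk F + i) <
        min (M.natRk (insert e F)) (N.natRk (insert e F) + i) := fun e he => by
      rw [← natRk_higgsLift h i (Set.insert_subset he.1 hFE)]; exact hF' e he
    have hle := h.natRk_le F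
    by_cases hc : setNullity M N F < i
    · refine Or.inr ⟨M.isFlat_iff_natRk.2 ⟨hFE, fun e he => ?_⟩, hc⟩
      have := key e he
      unfold setNullity at hc
      omega
    · refine Or.inl (N.isFlat_iff_natRk.2 ⟨hE ▸ hFE, fun e he => ?_⟩)
      have := key e (hE ▸ he)
      unfold setNullity at hc
      omega
  · intro hF
    have hMF : M.IsFlat F := hF.elim h.isFlat And.left
    have hFE := hMF.subset_ground
    refine (higgsLift h i).isFlat_iff_natRk.2 ⟨hFE, fun e he => ?_⟩
    have he' : e ∈ M.E \ F := he
    rw [natRk_higgsLift h i hFE, natRk_higgsLift h i (Set.insert_subset he'.1 hFE)]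
    have h1 := (M.isFlat_iff_natRk.1 hMF).2 e he'
    rcases hF with hF | ⟨-, hc⟩
    · have h2 := (N.isFlat_iff_natRk.1 hF).2 e (hE ▸ he')
      omega
    · have h2 : N.natRk F ≤ N.natRk (insert e F) := by
        have := N.eRk_mono (Set.subset_insert e F)
        rw [← natCast_natRk, ← natCast_natRk] at this
        exact_mod_cast this
      have h3 := h.natRk_le F
      unfold setNullity at hc
      omega

/-- Consecutive Higgs lifts form quotients `Lⁱ⁺¹ ↠ Lⁱ`. -/
lemma higgsLift_succ_isQuotient [M.Finite] (h : M.IsQuotient N) (i : ℕ) :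
    (higgsLift h (i + 1)).IsQuotient (higgsLift h i) :=
  isQuotient_of_isFlat rfl fun F hF => by
    rw [isFlat_higgsLift_iff] at hF ⊢
    exact hF.imp_right fun h' => ⟨h'.1, h'.2.trans (Nat.lt_succ_self i)⟩

/-- The Higgs factorization `Lᵏ ↠ Lᵏ⁻¹ ↠ ⋯ ↠ L¹ ↠ L⁰` of a quotient of nullity `k`, as a diagram
of matroids: the matroids are the Higgs lifts `L⁰, …, Lᵏ`, and the morphisms are the quotient maps
`Lⁱ⁺¹ ↠ Lⁱ` for `i < k`. -/
noncomputable def higgsFactorization [M.Finite] (h : M.IsQuotient N) : Diagram.{u} where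
  Obj := Fin (quotientNullity M N + 1)
  Hom := Fin (quotientNullity M N)
  carrier _ := α
  mat i := higgsLift h i
  src i := i.succ
  tgt i := i.castSucc
  map _ := id
  isMorphism i := (higgsLift_succ_isQuotient h i).2

/-- `M ⊕ U_{k,k} ↠ N ⊕ U_{0,k}` is a quotient if `M ↠ N` is. -/
lemma IsQuotient.sum_free_loopy (h : M.IsQuotient N) (k : ℕ) :
    (M.sum (freeOn (Set.univ : Set (Fin k)))).IsQuotient
      (N.sum (loopyOn (Set.univ : Set (Fin k)))) := by
  refine isQuotient_of_isFlat (by simp [h.1]) fun F hF => ?_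
  rw [sum_isFlat_iff] at hF ⊢
  refine ⟨h.isFlat hF.1, ?_⟩
  have : Sum.inr ⁻¹' F = (Set.univ : Set (Fin k)) := by
    rw [← hF.2.closure]; simp
  rw [this]
  exact (freeOn (Set.univ : Set (Fin k))).ground_isFlat

instance sum_finite (M : Matroid α) (P : Matroid β) [hM : M.Finite] [hP : P.Finite] :
    (M.sum P).Finite :=
  ⟨by rw [sum_ground]; exact (hM.ground_finite.image _).union (hP.ground_finite.image _)⟩

instance freeOn_univ_fin_finite (k : ℕ) : (freeOn (Set.univ : Set (Fin k))).Finite :=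
  ⟨Set.toFinite _⟩

/-- The Higgs major of a quotient `M ↠ N` of nullity `k`: the `k`-th Higgs lift of the quotient
`M ⊕ U_{k,k} ↠ N ⊕ U_{0,k}`, on the disjoint union of the ground set with `k` new elements. -/
noncomputable def higgsMajor [M.Finite] (h : M.IsQuotient N) :
    Matroid (α ⊕ Fin (quotientNullity M N)) :=
  higgsLift (h.sum_free_loopy (quotientNullity M N)) (quotientNullity M N)

end HiggsLift

end Matroid

/-! Let `g : V → W` realize the quotient and let `Z` be its kernel, of dimension `k`. By
rank-nullity, the span of `φ '' A` meets `Z` in dimension `n(A)`. Over an infinite field,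
`Submodule.exists_generic_chain` gives an increasing chain of subspaces `U_j` of `Z` in general
position to these finitely many intersections. In `V ⧸ U_j` with `j = k - i`, the rank of `A` is
`rk₂ A + min (n(A) + j) k - j = min (rk₁ A) (rk₂ A + i)`, which is its rank in the `i`-th Higgs
lift. Thus one chain realizes all the lifts (`exists_realizes_higgsLift`), and the canonical
projections between the quotients of `V` realize the arrows. Adding `k` independent vectors that map
to zero and applying the same result to the enlarged quotient realizes the Higgs major.

The converses hold over any field. The arrows of a realized factorization compose to a map from `L^k
= M₁` to `L^0 = M₂`. In a realized Higgs major, the vectors of `E` realize `M₁`, and their images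
modulo the span of the `k` new vectors realize `M₂`: the major restricts to `M₁` on `E` and
contracts to `M₂`. -/

/-! ### Linear algebra: subspaces in general position and dimension counts. -/

section GenericChain

variable {K V : Type*} [Field K] [AddCommGroup V] [Module K V]

/-- A vector space over an infinite field is not a finite union of proper subspaces. This is the
only source of genericity in the proof. -/
lemma Submodule.exists_mem_forall_notMem_of_lt [Infinite K] (Z : Submodule K V) {ι : Type*}
    [Finite ι] (S : ι → Submodule K V) (hS : ∀ i, S i < Z) : ∃ u ∈ Z, ∀ i, u ∉ S i := by
  by_contra! hcon
  obtain ⟨i, hi⟩ := Subspace.exists_eq_top_of_iUnion_eq_univ (k := K)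
    (p := fun i => (S i).comap Z.subtype) (by
      ext ⟨u, hu⟩
      simpa using hcon u hu)
  rw [Submodule.comap_subtype_eq_top] at hi
  exact (hS i).not_ge hi

/-- A chain of subspaces of `Z`, starting from `⊥`, which is in general position with respect to
finitely many given subspaces of `Z`. -/
lemma Submodule.exists_generic_chain [Infinite K] [FiniteDimensional K V] (Z : Submodule K V)
    {ι : Type*} [Finite ι] (S : ι → Submodule K V) (hS : ∀ i, S i ≤ Z) :
    ∃ U : ℕ → Submodule K V, Monotone U ∧ U 0 = ⊥ ∧ (∀ j, U j ≤ Z) ∧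
      ∀ j i, Module.finrank K ↥(S i ⊔ U j) =
        min (Module.finrank K (S i) + j) (Module.finrank K Z) := by
  have step : ∀ U : {U : Submodule K V // U ≤ Z}, ∃ U' : {U : Submodule K V // U ≤ Z},
      U.1 ≤ U'.1 ∧ ∀ i, Module.finrank K ↥(S i ⊔ U'.1) =
        min (Module.finrank K ↥(S i ⊔ U.1) + 1) (Module.finrank K Z) := by
    rintro ⟨U, hU⟩
    -- A single vector `u` raises every `S i ⊔ U` that is not yet all of `Z` by exactly one
    -- dimension; those equal to `Z` stay put, whence the `min`.
    obtain ⟨u, huZ, hu⟩ := Z.exists_mem_forall_notMem_of_lt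
      (fun i : {i // S i ⊔ U ≠ Z} => S i ⊔ U) (fun i => (sup_le (hS i) hU).lt_of_ne i.2)
    have huZ' : K ∙ u ≤ Z := (Submodule.span_singleton_le_iff_mem u Z).2 huZ
    refine ⟨⟨U ⊔ K ∙ u, sup_le hU huZ'⟩, le_sup_left, fun i => ?_⟩
    rw [← sup_assoc]
    change _ = min (Module.finrank K ↥(S i ⊔ U) + 1) _
    by_cases hi : S i ⊔ U = Z
    · rw [hi, sup_eq_left.2 huZ']; simp
    · have hui := hu ⟨i, hi⟩
      have h0 : u ≠ 0 := fun h => hui (h ▸ Submodule.zero_mem _)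
      have h1 := Submodule.finrank_sup_add_finrank_inf_eq (S i ⊔ U) (K ∙ u)
      rw [((Submodule.disjoint_span_singleton' h0).2 hui).eq_bot, finrank_bot,
        finrank_span_singleton h0] at h1
      have h2 := Submodule.finrank_mono (sup_le (sup_le (hS i) hU) huZ')
      omega
  choose g hg1 hg2 using step
  refine ⟨fun j => (g^[j] ⟨⊥, bot_le⟩).1, monotone_nat_of_le_succ fun j => ?_, rfl,
    fun j => (g^[j] ⟨⊥, bot_le⟩).2, fun j i => ?_⟩
  · rw [Function.iterate_succ_apply']
    exact hg1 _
  · beta_reduce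
    induction j with
    | zero =>
      rw [Function.iterate_zero_apply, sup_bot_eq]
      simpa using Submodule.finrank_mono (hS i)
    | succ j ih =>
      rw [Function.iterate_succ_apply', hg2, ih]
      omega

lemma Submodule.finrank_map_add_finrank_inf_ker [FiniteDimensional K V] {W : Type*}
    [AddCommGroup W] [Module K W] (g : V →ₗ[K] W) (T : Submodule K V) :
    Module.finrank K (T.map g) + Module.finrank K ↥(T ⊓ LinearMap.ker g) = Module.finrank K T := by
  have h := LinearMap.finrank_range_add_finrank_ker (g.domRestrict T)
  rw [LinearMap.range_domRestrict, LinearMap.ker_domRestrict,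
    ← Submodule.finrank_map_subtype_eq, Submodule.map_comap_subtype] at h
  exact h

/-- The rank of a subspace modulo `U`, in terms of its image and kernel under a map that
vanishes on `U`. -/
lemma Submodule.finrank_map_mkQ_of_le_ker [FiniteDimensional K V] {W : Type*}
    [AddCommGroup W] [Module K W] (g : V →ₗ[K] W) {U : Submodule K V} (hU : U ≤ LinearMap.ker g)
    (T : Submodule K V) :
    Module.finrank K (T.map U.mkQ) + Module.finrank K U =
      Module.finrank K (T.map g) + Module.finrank K ↥(T ⊓ LinearMap.ker g ⊔ U) := by
  -- Rank-nullity is applied to `T ⊔ U` twice, for the projection modulo `U` and for `g`; the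
  -- modular law rewrites `(T ⊔ U) ⊓ ker g` as `(T ⊓ ker g) ⊔ U`.
  have h1 := Submodule.finrank_map_add_finrank_inf_ker U.mkQ (T ⊔ U)
  have h2 := Submodule.finrank_map_add_finrank_inf_ker g (T ⊔ U)
  rw [Submodule.map_sup, Submodule.ker_mkQ, inf_eq_right.2 le_sup_right, Submodule.mkQ_map_self,
    sup_bot_eq] at h1
  rw [Submodule.map_sup, (LinearMap.le_ker_iff_map (f := g)).1 hU, sup_bot_eq, sup_comm,
    sup_inf_assoc_of_le T hU, sup_comm, sup_comm U] at h2
  omega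

lemma Submodule.finrank_prod_eq_add [FiniteDimensional K V] {W : Type*} [AddCommGroup W]
    [Module K W] [FiniteDimensional K W] (S : Submodule K V) (T : Submodule K W) :
    Module.finrank K (S.prod T) = Module.finrank K S + Module.finrank K T := by
  rw [← Module.finrank_prod, ← LinearMap.finrank_range_of_inj
    (f := S.subtype.prodMap T.subtype) (S.subtype_injective.prodMap T.subtype_injective),
    LinearMap.range_prodMap, Submodule.range_subtype, Submodule.range_subtype]

end GenericChain

/-! ### Rank functions of sums and quotients. -/

namespace Matroid

variable {α : Type u} {β : Type*} {K : Type v} [Field K]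

lemma indep_iff_natRk (M : Matroid α) [M.Finite] {A : Set α} (hA : A ⊆ M.E) :
    M.Indep A ↔ M.natRk A = A.ncard := by
  have hfin := M.set_finite A hA
  rw [indep_iff_eRk_eq_encard_of_finite hfin, ← natCast_natRk, ← hfin.cast_ncard_eq,
    Nat.cast_inj]

lemma natRk_sum (M : Matroid α) (N : Matroid β) [M.Finite] [N.Finite] {A : Set (α ⊕ β)}
    (hA : A ⊆ (M.sum N).E) :
    (M.sum N).natRk A = M.natRk (Sum.inl ⁻¹' A) + N.natRk (Sum.inr ⁻¹' A) := by
  obtain ⟨I, hI⟩ := (M.sum N).exists_isBasis A hA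
  have hI' := sum_isBasis_iff.1 hI
  have h : (M.sum N).eRk A = M.eRk (Sum.inl ⁻¹' A) + N.eRk (Sum.inr ⁻¹' A) := by
    rw [← hI.encard_eq_eRk, ← hI'.1.encard_eq_eRk, ← hI'.2.encard_eq_eRk,
      ← (Sum.inl_injective (β := β)).encard_image (Sum.inl ⁻¹' I),
      ← (Sum.inr_injective (α := α)).encard_image (Sum.inr ⁻¹' I),
      ← Set.encard_union_eq Set.disjoint_image_inl_image_inr,
      Set.image_preimage_inl_union_image_preimage_inr]
  simp only [← natCast_natRk] at h
  exact_mod_cast h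

/-- Extend an `M`-basis `I` of `A` to an `M`-basis `J` of `B`. Since `J` also spans `B` in `N`,
passing from `A` to `B` raises the `N`-rank by at most `|J \ I|`, the growth of the `M`-rank. The
additive form avoids truncated subtraction. -/
lemma IsQuotient.setNullity_mono {M N : Matroid α} [M.Finite] (h : M.IsQuotient N) {A B : Set α}
    (hAB : A ⊆ B) (hB : B ⊆ M.E) : M.natRk A + N.natRk B ≤ M.natRk B + N.natRk A := by
  have := h.finite
  obtain ⟨I, hI⟩ := M.exists_isBasis A (hAB.trans hB)
  obtain ⟨J, hJ, hIJ⟩ := hI.indep.subset_isBasis_of_subset (hI.subset.trans hAB) hB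
  have h1 : N.eRk B ≤ N.eRk A + (J \ I).encard :=
    calc N.eRk B ≤ N.eRk (N.closure J) := N.eRk_mono (hJ.subset_closure.trans (h.closure_subset J))
      _ = N.eRk J := N.eRk_closure_eq J
      _ ≤ N.eRk (A ∪ J \ I) := N.eRk_mono fun x hx => by
        by_cases hxI : x ∈ I
        · exact Or.inl (hI.subset hxI)
        · exact Or.inr ⟨hx, hxI⟩
      _ ≤ _ := N.eRk_union_le_eRk_add_encard _ _
  have h2 : M.eRk A + N.eRk B ≤ M.eRk B + N.eRk A := by
    rw [← hI.encard_eq_eRk, ← hJ.encard_eq_eRk, ← Set.encard_sdiff_add_encard_of_subset hIJ,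
      add_comm _ I.encard, add_assoc]
    gcongr
    rwa [add_comm]
  simp only [← natCast_natRk] at h2
  exact_mod_cast h2

lemma IsQuotient.natRk_le_add_quotientNullity {M N : Matroid α} [M.Finite] (h : M.IsQuotient N)
    {A : Set α} (hA : A ⊆ M.E) : M.natRk A ≤ N.natRk A + quotientNullity M N := by
  have h1 := h.setNullity_mono hA subset_rfl
  have h2 := h.natRk_le M.E
  rw [quotientNullity, ← h.1]
  omega

/-! ### Realizations as rank-preserving maps. -/

section Realizes

variable {V : Type v} [AddCommGroup V] [Module K V]

lemma linearIndepOn_iff_finrank_span {A : Set α} (hA : A.Finite) (φ : α → V) :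
    LinearIndepOn K φ A ↔ Module.finrank K (Submodule.span K (φ '' A)) = A.ncard := by
  have := hA.fintype
  rw [LinearIndepOn, linearIndependent_iff_card_eq_finrank_span, Set.finrank,
    ← Set.image_eq_range, ← Nat.card_eq_fintype_card, Nat.card_coe_set_eq, eq_comm]

/-- A realization is a map that preserves ranks. -/
lemma realizes_iff_finrank {M : Matroid α} [M.Finite] {φ : α → V} :
    M.Realizes K V φ ↔ Module.Finite K V ∧ Module.finrank K V = M.natRk M.E ∧
      ∀ A ⊆ M.E, Module.finrank K (Submodule.span K (φ '' A)) = M.natRk A := by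
  rw [Realizes, eRank_def, ← natCast_natRk, Nat.cast_inj]
  refine and_congr_right fun _ => and_congr_right fun _ => ⟨fun h A hA => ?_, fun h A hA => ?_⟩
  · obtain ⟨I, hI⟩ := M.exists_isBasis A hA
    have hIE := hI.indep.subset_ground
    have hlin := (h I hIE).1 hI.indep
    -- A vector `φ e` outside the span of the basis `I` would make `insert e I` independent, against
    -- the maximality of `I` in `A`.
    have hspan : Submodule.span K (φ '' A) = Submodule.span K (φ '' I) := by
      refine le_antisymm (Submodule.span_le.2 ?_) (Submodule.span_mono (Set.image_mono hI.subset))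
      rintro _ ⟨e, he, rfl⟩
      by_contra hcon
      have heI : e ∈ I := hI.mem_of_insert_indep he
        ((h _ (Set.insert_subset (hA he) hIE)).2 (hlin.insert hcon))
      exact hcon (Submodule.subset_span ⟨e, heI, rfl⟩)
    rw [hspan, (linearIndepOn_iff_finrank_span (M.set_finite I hIE) φ).1 hlin,
      ← (M.indep_iff_natRk hIE).1 hI.indep, natRk, natRk, hI.eRk_eq_eRk]
  · rw [M.indep_iff_natRk hA, linearIndepOn_iff_finrank_span (M.set_finite A hA), h A hA]

lemma Realizes.span_image_ground {M : Matroid α} [M.Finite] {φ : α → V} (h : M.Realizes K V φ) :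
    Submodule.span K (φ '' M.E) = ⊤ := by
  obtain ⟨h1, h2, h3⟩ := realizes_iff_finrank.1 h
  exact Submodule.eq_top_of_finrank_eq ((h3 _ subset_rfl).trans h2.symm)

lemma realizes_of_span_image_ground {M : Matroid α} [M.Finite] [Module.Finite K V] {φ : α → V}
    (h : Submodule.span K (φ '' M.E) = ⊤)
    (h' : ∀ A ⊆ M.E, Module.finrank K (Submodule.span K (φ '' A)) = M.natRk A) :
    M.Realizes K V φ :=
  realizes_iff_finrank.2 ⟨‹_›, by rw [← h' _ subset_rfl, h, finrank_top], h'⟩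

lemma Realizes.sum {M : Matroid α} {N : Matroid β} [M.Finite] [N.Finite] {W : Type v}
    [AddCommGroup W] [Module K W] {φ : α → V} {ψ : β → W} (hφ : M.Realizes K V φ)
    (hψ : N.Realizes K W ψ) :
    (M.sum N).Realizes K (V × W) (Sum.elim (fun e => (φ e, 0)) (fun e => (0, ψ e))) := by
  have key : ∀ A : Set (α ⊕ β), Submodule.span K
      ((Sum.elim (fun e => (φ e, (0 : W))) (fun e => ((0 : V), ψ e))) '' A) =
      (Submodule.span K (φ '' (Sum.inl ⁻¹' A))).prod (Submodule.span K (ψ '' (Sum.inr ⁻¹' A))) := by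
    intro A
    conv_lhs => rw [← Set.image_preimage_inl_union_image_preimage_inr A]
    rw [Set.image_union, Set.image_image, Set.image_image, Submodule.span_union,
      LinearMap.prod_eq_sup_map, Submodule.map_span, Submodule.map_span, Set.image_image,
      Set.image_image]
    rfl
  have := hφ.1
  have := hψ.1
  refine realizes_of_span_image_ground ?_ fun A hA => ?_
  · have h1 : Sum.inl ⁻¹' (M.sum N).E = M.E := by ext; simp
    have h2 : Sum.inr ⁻¹' (M.sum N).E = N.E := by ext; simp
    rw [key, h1, h2, hφ.span_image_ground, hψ.span_image_ground, Submodule.prod_top]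
  · rw [natRk_sum M N hA, key,
      ← (realizes_iff_finrank.1 hφ).2.2 _ (fun e he => by simpa using hA he),
      ← (realizes_iff_finrank.1 hψ).2.2 _ (fun e he => by simpa using hA he),
      Submodule.finrank_prod_eq_add]

end Realizes

end Matroid

/-! ### The implications between the three realizability conditions. -/

namespace Matroid

variable {α : Type u} {K : Type v} [Field K] {M N : Matroid α}

/-- A realization of a quotient over an infinite field yields realizations of all of its Higgs
lifts, in the quotients of a single vector space by a chain of subspaces. -/
lemma MorphismRealizable.exists_realizes_higgsLift [Infinite K] [M.Finite] (f : M.IsQuotient N)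
    (h : MorphismRealizable K M N id) :
    ∃ (V : Type v) (_ : AddCommGroup V) (_ : Module K V) (φ : α → V) (U : ℕ → Submodule K V),
      Antitone U ∧ ∀ i, (higgsLift f i).Realizes K (V ⧸ U i) (fun e => (U i).mkQ (φ e)) := by
  have := f.finite
  obtain ⟨V, W, _, _, _, _, φ, ψ, g, hφ, hψ, hg⟩ := h
  have := hφ.1
  have hrkM := (realizes_iff_finrank.1 hφ).2.2
  have hrkN := (realizes_iff_finrank.1 hψ).2.2
  have hmap : ∀ A ⊆ M.E, (Submodule.span K (φ '' A)).map g = Submodule.span K (ψ '' A) := by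
    intro A hA
    rw [Submodule.map_span, Set.image_image]
    congr 1
    exact Set.image_congr fun e he => hg e (hA he)
  -- The nullity of `A` is the dimension in which its span meets the kernel; for `A = M.E` this
  -- gives the dimension of the kernel itself.
  have hker : ∀ A ⊆ M.E, N.natRk A +
      Module.finrank K ↥(Submodule.span K (φ '' A) ⊓ LinearMap.ker g) = M.natRk A := by
    intro A hA
    rw [← hrkM A hA, ← hrkN A (f.1 ▸ hA), ← hmap A hA]
    exact Submodule.finrank_map_add_finrank_inf_ker g _
  have hkerE := hker M.E subset_rfl
  rw [hφ.span_image_ground, top_inf_eq] at hkerE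
  have : Finite {A : Set α // A ⊆ M.E} := M.ground_finite.finite_subsets.to_subtype
  obtain ⟨U, hU, -, hUker, hgen⟩ := (LinearMap.ker g).exists_generic_chain
    (fun A : {A : Set α // A ⊆ M.E} => Submodule.span K (φ '' A) ⊓ LinearMap.ker g)
    (fun _ => inf_le_right)
  have hgen' : ∀ j, ∀ A ⊆ M.E,
      Module.finrank K ↥(Submodule.span K (φ '' A) ⊓ LinearMap.ker g ⊔ U j) =
        min (Module.finrank K ↥(Submodule.span K (φ '' A) ⊓ LinearMap.ker g) + j)
          (Module.finrank K (LinearMap.ker g)) :=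
    fun j A hA => hgen j ⟨A, hA⟩
  -- General position with respect to the zero subspace, that is, `A = ∅`.
  have hUrk : ∀ j, Module.finrank K (U j) = min j (Module.finrank K (LinearMap.ker g)) := by
    intro j
    have h1 := hgen' j ∅ (Set.empty_subset _)
    rwa [Set.image_empty, Submodule.span_empty, bot_inf_eq, bot_sup_eq, finrank_bot,
      zero_add] at h1
  -- The index is reversed: a smaller lift is a quotient by a larger subspace. For `i` beyond the
  -- nullity the truncated difference is `0`, and the lift is `M` itself.
  refine ⟨V, _, _, φ, fun i => U (quotientNullity M N - i),
    fun i j hij => hU (Nat.sub_le_sub_left hij _), fun i => ?_⟩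
  have hspan : ∀ A : Set α, Submodule.span K
      ((fun e => (U (quotientNullity M N - i)).mkQ (φ e)) '' A) =
        (Submodule.span K (φ '' A)).map (U (quotientNullity M N - i)).mkQ := by
    intro A
    rw [Submodule.map_span, Set.image_image]
  refine realizes_of_span_image_ground ?_ fun A hA => ?_
  · rw [hspan, higgsLift_ground, hφ.span_image_ground, Submodule.map_top, Submodule.range_mkQ]
  · rw [higgsLift_ground] at hA
    have h1 := Submodule.finrank_map_mkQ_of_le_ker g (hUker (quotientNullity M N - i))
      (Submodule.span K (φ '' A))
    rw [hUrk, hmap A hA, hrkN A (f.1 ▸ hA), hgen' _ A hA] at h1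
    have h2 := hker A hA
    have h3 := f.natRk_le_add_quotientNullity hA
    have h4 : quotientNullity M N = M.natRk M.E - N.natRk M.E := by rw [quotientNullity, f.1]
    rw [hspan, natRk_higgsLift f i hA]
    dsimp only at h1 ⊢
    omega

lemma higgsLift_zero [M.Finite] (f : M.IsQuotient N) : higgsLift f 0 = N := by
  have := f.finite
  refine ext_indep f.1 fun I hI => ?_
  rw [indep_iff_natRk _ hI, indep_iff_natRk _ (f.1 ▸ hI), natRk_higgsLift f 0 hI]
  have := f.natRk_le I
  simp [this]

lemma higgsLift_quotientNullity [M.Finite] (f : M.IsQuotient N) :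
    higgsLift f (quotientNullity M N) = M := by
  refine ext_indep rfl fun I hI => ?_
  rw [indep_iff_natRk _ hI, indep_iff_natRk M hI, natRk_higgsLift f _ hI,
    min_eq_left (f.natRk_le_add_quotientNullity hI)]

lemma higgsFactorization_realizable_iff [M.Finite] (f : M.IsQuotient N) :
    (higgsFactorization f).Realizable K ↔
      ∃ (V : Fin (quotientNullity M N + 1) → Type v) (_ : ∀ i, AddCommGroup (V i))
        (_ : ∀ i, Module K (V i)) (φ : ∀ i, α → V i),
        (∀ i : Fin (quotientNullity M N + 1), (higgsLift f i).Realizes K (V i) (φ i)) ∧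
        ∀ i : Fin (quotientNullity M N), ∃ g : V i.succ →ₗ[K] V i.castSucc,
          ∀ e ∈ M.E, g (φ i.succ e) = φ i.castSucc e :=
  Iff.rfl

lemma MorphismRealizable.higgsFactorization_realizable [Infinite K] [M.Finite]
    (f : M.IsQuotient N) (h : MorphismRealizable K M N id) :
    (higgsFactorization f).Realizable K := by
  obtain ⟨V, _, _, φ, U, hU, hφ⟩ := h.exists_realizes_higgsLift f
  exact (higgsFactorization_realizable_iff f).2 ⟨fun i => V ⧸ U i, _, _,
    fun i e => (U i).mkQ (φ e), fun i => hφ i,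
    -- All the realizations descend from the same `φ`, so the canonical projections commute with
    -- them by definition.
    fun i => ⟨Submodule.factor (hU (Nat.le_succ i.val)), fun _ _ => rfl⟩⟩

lemma morphismRealizable_of_higgsFactorization [M.Finite] (f : M.IsQuotient N)
    (h : (higgsFactorization f).Realizable K) : MorphismRealizable K M N id := by
  obtain ⟨V, _, _, φ, hφ, hg⟩ := (higgsFactorization_realizable_iff f).1 h
  have key : ∀ i, ∃ g : V i →ₗ[K] V 0, ∀ e ∈ M.E, g (φ i e) = φ 0 e := by
    intro i
    induction i using Fin.induction with
    | zero => exact ⟨LinearMap.id, fun _ _ => rfl⟩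
    | succ i ih =>
      obtain ⟨g, hg1⟩ := ih
      obtain ⟨g', hg2⟩ := hg i
      exact ⟨g ∘ₗ g', fun e he => by rw [LinearMap.comp_apply, hg2 e he, hg1 e he]⟩
  obtain ⟨g, hg⟩ := key (Fin.last _)
  have h0 := hφ 0
  have hk := hφ (Fin.last _)
  rw [Fin.val_zero, higgsLift_zero] at h0
  rw [Fin.val_last, higgsLift_quotientNullity] at hk
  exact ⟨_, _, _, _, _, _, _, _, g, hk, h0, hg⟩

lemma realizes_freeOn_univ (k : ℕ) : (freeOn (Set.univ : Set (Fin k))).Realizes K (Fin k → K)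
    (fun i => Pi.single i 1) := by
  refine ⟨inferInstance, ?_, fun A _ => ?_⟩
  · simp [eRank_freeOn]
  · simpa using ((Pi.basisFun K (Fin k)).linearIndependent.linearIndepOn A).congr
      fun i _ => Pi.basisFun_apply K (Fin k) i

lemma realizes_loopyOn {β : Type*} (X : Set β) :
    (loopyOn X).Realizes K PUnit.{v + 1} (fun _ => 0) := by
  refine ⟨inferInstance, by simp [Module.finrank_zero_of_subsingleton], fun A _ => ?_⟩
  rw [loopyOn_indep_iff]
  refine ⟨fun h => h ▸ linearIndepOn_empty K _, fun h => ?_⟩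
  by_contra! hne
  obtain ⟨a, ha⟩ := hne
  exact h.ne_zero ha rfl

/-- The new elements become the standard basis of `Fin k → K`, which the linear map sends to zero.
-/
lemma MorphismRealizable.sum_free_loopy (h : MorphismRealizable K M N id) [M.Finite] [N.Finite]
    (k : ℕ) : MorphismRealizable K (M.sum (freeOn (Set.univ : Set (Fin k))))
      (N.sum (loopyOn (Set.univ : Set (Fin k)))) id := by
  obtain ⟨V, W, _, _, _, _, φ, ψ, g, hφ, hψ, hg⟩ := h
  have : (loopyOn (Set.univ : Set (Fin k))).Finite := ⟨Set.toFinite _⟩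
  refine ⟨_, _, _, _, _, _, _, _, g.prodMap 0, hφ.sum (realizes_freeOn_univ k),
    hψ.sum (realizes_loopyOn Set.univ), ?_⟩
  rintro (e | e) he
  · simpa using hg e (by simpa using he)
  · simp

lemma MorphismRealizable.higgsMajor_realizable [Infinite K] [M.Finite]
    (f : M.IsQuotient N) (h : MorphismRealizable K M N id) : (higgsMajor f).Realizable K := by
  have := f.finite
  obtain ⟨V, _, _, φ, U, -, hφ⟩ :=
    (h.sum_free_loopy (quotientNullity M N)).exists_realizes_higgsLift (f.sum_free_loopy _)
  exact ⟨_, _, _, _, hφ _⟩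

/-- The rank function of the Higgs major. -/
lemma natRk_higgsMajor [M.Finite] (f : M.IsQuotient N) {A : Set α} (hA : A ⊆ M.E)
    (S : Set (Fin (quotientNullity M N))) :
    (higgsMajor f).natRk (Sum.inl '' A ∪ Sum.inr '' S) =
      min (M.natRk A + S.ncard) (N.natRk A + quotientNullity M N) := by
  have := f.finite
  have : (loopyOn (Set.univ : Set (Fin (quotientNullity M N)))).Finite := ⟨Set.toFinite _⟩
  have h1 : Sum.inl ⁻¹' (Sum.inl '' A ∪ Sum.inr '' S) = A := by ext; simp
  have h2 : Sum.inr ⁻¹' (Sum.inl '' A ∪ Sum.inr '' S) = S := by ext; simp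
  have h3 : (freeOn (Set.univ : Set (Fin (quotientNullity M N)))).natRk S = S.ncard :=
    (indep_iff_natRk _ (Set.subset_univ S)).1 (freeOn_indep (Set.subset_univ S))
  have h4 : (loopyOn (Set.univ : Set (Fin (quotientNullity M N)))).natRk S = 0 := by
    simp [natRk]
  have hE : Sum.inl '' A ∪ Sum.inr '' S ⊆
      (M.sum (freeOn (Set.univ : Set (Fin (quotientNullity M N))))).E := by
    rw [sum_ground]
    exact Set.union_subset_union (Set.image_mono hA) (Set.image_mono (Set.subset_univ S))
  rw [higgsMajor, natRk_higgsLift _ _ hE, natRk_sum _ _ hE, natRk_sum _ _ (by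
    rw [sum_ground, ← f.1]
    exact Set.union_subset_union (Set.image_mono hA) (Set.image_mono (Set.subset_univ S))),
    h1, h2, h3, h4, add_zero]

instance higgsMajor_finite [M.Finite] (f : M.IsQuotient N) : (higgsMajor f).Finite :=
  higgsLift_finite _ _

lemma morphismRealizable_of_higgsMajor [M.Finite] (f : M.IsQuotient N)
    (h : (higgsMajor f).Realizable K) : MorphismRealizable K M N id := by
  have := f.finite
  obtain ⟨V, _, _, φ, hφ⟩ := h
  obtain ⟨hV, hdim, hrk⟩ := realizes_iff_finrank.1 hφ
  have hground : (higgsMajor f).E = Sum.inl '' M.E ∪ Sum.inr '' Set.univ := by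
    simp [higgsMajor]
  have hrk' : ∀ A ⊆ M.E, ∀ S : Set (Fin (quotientNullity M N)), Module.finrank K
      ↥(Submodule.span K ((fun e => φ (Sum.inl e)) '' A) ⊔
        Submodule.span K ((fun i => φ (Sum.inr i)) '' S)) =
      min (M.natRk A + S.ncard) (N.natRk A + quotientNullity M N) := by
    intro A hA S
    rw [← natRk_higgsMajor f hA S, ← hrk _ (by
      rw [hground]
      exact Set.union_subset_union (Set.image_mono hA) (Set.image_mono (Set.subset_univ S))),
      Set.image_union, Set.image_image, Set.image_image, Submodule.span_union]
  have hnull := fun A hA => f.natRk_le_add_quotientNullity (A := A) hA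
  have hle := f.natRk_le M.E
  have hkE : quotientNullity M N = M.natRk M.E - N.natRk M.E := by rw [quotientNullity, f.1]
  -- With no new elements the first term of the minimum is the smaller one, as the nullity of `A` is
  -- at most that of the whole quotient.
  have hM : ∀ A ⊆ M.E, Module.finrank K
      (Submodule.span K ((fun e => φ (Sum.inl e)) '' A)) = M.natRk A := by
    intro A hA
    have h1 := hrk' A hA ∅
    have h2 := hnull A hA
    rw [Set.image_empty, Submodule.span_empty, sup_bot_eq, Set.ncard_empty] at h1
    omega
  set U := Submodule.span K
    ((fun i => φ (Sum.inr i)) '' (Set.univ : Set (Fin (quotientNullity M N)))) with hU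
  -- With all new elements the second term is the smaller one, since `rk_N A ≤ rk_M A`.
  have hN : ∀ A ⊆ M.E, Module.finrank K
      ↥(Submodule.span K ((fun e => φ (Sum.inl e)) '' A) ⊔ U) = N.natRk A + quotientNullity M N := by
    intro A hA
    have h1 := hrk' A hA Set.univ
    have h2 := f.natRk_le A
    rw [← hU, Set.ncard_univ, Nat.card_fin] at h1
    omega
  have hUrk : Module.finrank K U = quotientNullity M N := by
    have h1 := hN ∅ (Set.empty_subset _)
    rw [Set.image_empty, Submodule.span_empty, bot_sup_eq] at h1
    simpa [natRk] using h1
  have hdim' : Module.finrank K V = M.natRk M.E := by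
    rw [hdim, hground, natRk_higgsMajor f subset_rfl, Set.ncard_univ, Nat.card_fin]
    omega
  -- The major has the same rank as `M`, so the old elements alone span `V`.
  have hspan := Submodule.eq_top_of_finrank_eq ((hM _ subset_rfl).trans hdim'.symm)
  have hmap : ∀ A : Set α, Submodule.span K ((fun e => U.mkQ (φ (Sum.inl e))) '' A) =
      (Submodule.span K ((fun e => φ (Sum.inl e)) '' A)).map U.mkQ := by
    intro A
    rw [Submodule.map_span, Set.image_image]
  refine ⟨V, V ⧸ U, _, _, _, _, fun e => φ (Sum.inl e), fun e => U.mkQ (φ (Sum.inl e)), U.mkQ,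
    realizes_of_span_image_ground hspan hM, realizes_of_span_image_ground ?_ fun A hA => ?_,
    fun _ _ => rfl⟩
  · rw [hmap, ← f.1, hspan, Submodule.map_top, Submodule.range_mkQ]
  · rw [← f.1] at hA
    have h1 := Submodule.finrank_map_add_finrank_inf_ker U.mkQ
      (Submodule.span K ((fun e => φ (Sum.inl e)) '' A) ⊔ U)
    rw [Submodule.map_sup, Submodule.ker_mkQ, inf_eq_right.2 le_sup_right, Submodule.mkQ_map_self,
      sup_bot_eq, hUrk, hN A hA] at h1
    rw [hmap]
    omega

end Matroid

theorem theoremA {α : Type u} {K : Type v} [Field K] [Infinite K] (M₁ M₂ : Matroid α)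
    [M₁.Finite] (f : M₁.IsQuotient M₂) :
    List.TFAE [
      Matroid.MorphismRealizable K M₁ M₂ id,
      (Matroid.higgsFactorization f).Realizable K,
      (Matroid.higgsMajor f).Realizable K] := by
  tfae_have 1 → 2 := fun h => h.higgsFactorization_realizable f
  tfae_have 2 → 1 := Matroid.morphismRealizable_of_higgsFactorization f
  tfae_have 1 → 3 := fun h => h.higgsMajor_realizable f
  tfae_have 3 → 1 := Matroid.morphismRealizable_of_higgsMajor f
  tfae_finish
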